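/- Let $p$ be a prime, let $q=p^r\equiv 5 \pmod 8$, and let $\mathbb{F}_q$ be the finite field with $q$ elements. Let $G_4(q)$ be the quartic Paley digraph: its vertex set is $\mathbb{F}_q$, and $a\to b$ is an edge if and only if $b-a$ is a nonzero fourth power in $\mathbb{F}_q$. Let $\mathcal{K}_3(G_4(q))$ be the number of transitive subtournaments of order three contained in $G_4(q)$, i.e. the number of subdigraphs with three vertices that are transitive tournaments. Then one can write $q=x^2+y^2$ with integers $x,y$ such that $x\equiv 1\pmod 4$ and $p\nmid x$, and for every such $x$ and $y$ $$\mathcal{K}_3(G_4(q))=\frac{q(q-1)(q+2x-7)}{2^6}.$$ -/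

import Mathlib

/-- `S_k`: the subgroup of `k`-th power residues (i.e. the nonzero `k`-th powers) of the
multiplicative group of `F`. -/
def powerResidues (F : Type*) [Field F] (k : ℕ) : Subgroup Fˣ :=
  (powMonoidHom k : Fˣ →* Fˣ).range

/-- The `k`-th power Paley digraph of a (finite) field `F`: the vertices are the elements of `F`,
and `a → b` is an edge if and only if `b - a` is a `k`-th power residue. -/
def paleyDigraph (F : Type*) [Field F] (k : ℕ) : Digraph F where
  Adj a b := ∃ u ∈ powerResidues F k, (u : F) = b - a

/-- The subdigraph of `G` with vertex set `s` and with the edges of `T` is a transitive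
tournament. -/
structure IsTransitiveSubtournament {V : Type*} (G : Digraph V) (s : Finset V)
    (T : Digraph V) : Prop where
  /-- The edges join vertices of `s` and are edges of `G`. -/
  sub : ∀ a b, T.Adj a b → a ∈ s ∧ b ∈ s ∧ G.Adj a b
  /-- There are no loops. -/
  loopless : ∀ a, ¬ T.Adj a a
  /-- Any two distinct vertices are joined by an edge in exactly one direction. -/
  tournament : ∀ a ∈ s, ∀ b ∈ s, a ≠ b → Xor (T.Adj a b) (T.Adj b a)
  /-- The edge relation is transitive. -/
  transitive : ∀ a b c, T.Adj a b → T.Adj b c → T.Adj a c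

/-- `K_m(G)`: the number of transitive subtournaments of order `m` contained in `G`.
A subtournament is a subdigraph, that is, a pair of a vertex set and an edge relation on it. -/
noncomputable def numTransitiveSubtournaments {V : Type*} (m : ℕ) (G : Digraph V) : ℕ :=
  {P : Finset V × Digraph V | P.1.card = m ∧ IsTransitiveSubtournament G P.1 P.2}.ncard

/-! A transitive triple `a → b → c`, `a → c` is determined by `a`, the fourth power `d = c - a` and
`s = (b - a) / d`, where `s` and `1 - s` must be fourth powers. The count is thus `q · (q - 1)/4 ·
N`, with `N` a cyclotomic number.

For a quartic character `χ` with values in `ℤ[i]`, `16 N` is the sum of the Jacobi sums of all pairs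
of powers of `χ`. As `q ≡ 5 mod 8`, `χ (-1) = χ 4 = -1`, and everything reduces to `J = jacobiSum χ
(χ ^ 2)`: `16 N = q - 7 + 2 Re J` (`sixteen_mul_ncard_powerResidues_four`).

Since `|J|² = q`, the parts of `J` represent `q`. Integrality of `N` gives `Re J ≡ 1 mod 4`, and
reduction modulo a prime above `p` gives `p ∤ Re J` (`jacobiSum_quartic_not_dvd`). These conditions
determine `x` (`eq_of_prime_pow_eq_sq_add_sq`). -/

/-! ### Reduction to a cyclotomic number -/

/-- The transitive subtournaments of order three of a loopless digraph correspond to the triples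
`(a, b, c)` with `a → b`, `b → c` and `a → c`. -/
theorem numTransitiveSubtournaments_three {V : Type*} (G : Digraph V) (hG : ∀ a, ¬ G.Adj a a) :
    numTransitiveSubtournaments 3 G =
      {t : V × V × V | G.Adj t.1 t.2.1 ∧ G.Adj t.2.1 t.2.2 ∧ G.Adj t.1 t.2.2}.ncard := by
  classical
  symm
  refine Set.ncard_congr (fun t _ ↦ (({t.1, t.2.1, t.2.2} : Finset V),
    (⟨fun x y ↦ (x = t.1 ∧ y = t.2.1) ∨ (x = t.2.1 ∧ y = t.2.2) ∨ (x = t.1 ∧ y = t.2.2)⟩ :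
      Digraph V))) ?_ ?_ ?_
  · rintro ⟨a, b, c⟩ ⟨hab, hbc, hac⟩
    dsimp only at hab hbc hac ⊢
    have h1 : a ≠ b := by rintro rfl; exact hG _ hab
    have h2 : b ≠ c := by rintro rfl; exact hG _ hbc
    have h3 : a ≠ c := by rintro rfl; exact hG _ hac
    refine ⟨Finset.card_eq_three.2 ⟨a, b, c, h1, h3, h2, rfl⟩, ?_, ?_, ?_, ?_⟩
    · rintro x y (⟨rfl, rfl⟩ | ⟨rfl, rfl⟩ | ⟨rfl, rfl⟩) <;> simp_all
    · rintro x (⟨rfl, h⟩ | ⟨rfl, h⟩ | ⟨rfl, h⟩) <;> simp_all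
    · intro x hx y hy hxy
      simp only [Finset.mem_insert, Finset.mem_singleton] at hx hy
      rcases hx with rfl | rfl | rfl <;> rcases hy with rfl | rfl | rfl <;> simp_all [Xor, eq_comm]
    · rintro x y z (⟨rfl, h⟩ | ⟨rfl, h⟩ | ⟨rfl, h⟩) (⟨rfl, h'⟩ | ⟨rfl, h'⟩ | ⟨rfl, h'⟩) <;> simp_all
  · rintro ⟨a, b, c⟩ ⟨a', b', c'⟩ ⟨hab, hbc, hac⟩ ⟨hab', hbc', hac'⟩ h
    dsimp only at hab hbc hac hab' hbc' hac' h
    have h1 : a ≠ b := by rintro rfl; exact hG _ hab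
    have h2 : b ≠ c := by rintro rfl; exact hG _ hbc
    have h3 : a ≠ c := by rintro rfl; exact hG _ hac
    have h1' : a' ≠ b' := by rintro rfl; exact hG _ hab'
    have h2' : b' ≠ c' := by rintro rfl; exact hG _ hbc'
    have h3' : a' ≠ c' := by rintro rfl; exact hG _ hac'
    have hT := congrArg Digraph.Adj (Prod.ext_iff.1 h).2
    have key (x y : V) : ((x = a ∧ y = b) ∨ (x = b ∧ y = c) ∨ (x = a ∧ y = c)) ↔
        ((x = a' ∧ y = b') ∨ (x = b' ∧ y = c') ∨ (x = a' ∧ y = c')) :=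
      iff_of_eq (congrFun (congrFun hT x) y)
    have k1 := (key a b).1 (by simp)
    have k2 := (key b c).1 (by simp)
    have k3 := (key a c).1 (by simp)
    simp only [Prod.mk.injEq]
    clear key hT h hab hbc hac hab' hbc' hac'
    grind
  · rintro ⟨s, T⟩ ⟨hs, hT⟩
    obtain ⟨x, y, z, hxy, hxz, hyz, rfl⟩ := Finset.card_eq_three.1 hs
    dsimp only at hs hT
    have build (a b c : V) (hset : ({x, y, z} : Finset V) = {a, b, c})
        (hab : T.Adj a b) (hbc : T.Adj b c) (hac : T.Adj a c) :
        ∃ t, ∃ (_ : t ∈ {t : V × V × V | G.Adj t.1 t.2.1 ∧ G.Adj t.2.1 t.2.2 ∧ G.Adj t.1 t.2.2}),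
          (({t.1, t.2.1, t.2.2} : Finset V),
          (⟨fun x y ↦ (x = t.1 ∧ y = t.2.1) ∨ (x = t.2.1 ∧ y = t.2.2) ∨
            (x = t.1 ∧ y = t.2.2)⟩ : Digraph V)) = (({x, y, z} : Finset V), T) := by
      refine ⟨(a, b, c), ⟨(hT.sub _ _ hab).2.2, (hT.sub _ _ hbc).2.2, (hT.sub _ _ hac).2.2⟩, ?_⟩
      refine Prod.ext hset.symm (Digraph.ext (funext fun u ↦ funext fun v ↦ propext ?_))
      dsimp only
      constructor
      · rintro (⟨rfl, rfl⟩ | ⟨rfl, rfl⟩ | ⟨rfl, rfl⟩) <;> assumption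
      · intro huv
        have hu := (hT.sub _ _ huv).1
        have hv := (hT.sub _ _ huv).2.1
        rw [hset, Finset.mem_insert, Finset.mem_insert, Finset.mem_singleton] at hu hv
        have asymm (p q : V) (h : T.Adj p q) : ¬ T.Adj q p :=
          fun h' ↦ hT.loopless _ (hT.transitive _ _ _ h h')
        have := hT.loopless
        rcases hu with rfl | rfl | rfl <;> rcases hv with rfl | rfl | rfl <;> simp_all
    have t1 := (hT.tournament x (by simp) y (by simp) hxy).or
    have t2 := (hT.tournament x (by simp) z (by simp) hxz).or
    have t3 := (hT.tournament y (by simp) z (by simp) hyz).or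
    have tr := hT.transitive
    -- Six of the eight orientations are linear orders; the two cyclic ones would produce a loop.
    rcases t1 with h1 | h1 <;> rcases t2 with h2 | h2 <;> rcases t3 with h3 | h3
    · exact build x y z rfl h1 h3 h2
    · exact build x z y (by ext; simp; tauto) h2 h3 h1
    · exact (hT.loopless _ (tr _ _ _ h1 (tr _ _ _ h3 h2))).elim
    · exact build z x y (by ext; simp; tauto) h2 h1 h3
    · exact build y x z (by ext; simp; tauto) h1 h2 h3
    · exact (hT.loopless _ (tr _ _ _ h1 (tr _ _ _ h2 h3))).elim
    · exact build y z x (by ext; simp; tauto) h3 h2 h1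
    · exact build z y x (by ext; simp; tauto) h3 h1 h2

/-- The number of transitive triples in a power Paley digraph. -/
theorem ncard_transitive_triples_paleyDigraph (F : Type*) [Field F] [Finite F] (k : ℕ) :
    {t : F × F × F | (paleyDigraph F k).Adj t.1 t.2.1 ∧ (paleyDigraph F k).Adj t.2.1 t.2.2 ∧
      (paleyDigraph F k).Adj t.1 t.2.2}.ncard =
    Nat.card F * (Nat.card (powerResidues F k) *
      {s : F | (∃ u ∈ powerResidues F k, (u : F) = s) ∧
        ∃ u ∈ powerResidues F k, (u : F) = 1 - s}.ncard) := by
  set N : Set F := {s : F | (∃ u ∈ powerResidues F k, (u : F) = s) ∧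
    ∃ u ∈ powerResidues F k, (u : F) = 1 - s}
  rw [← Nat.card_coe_set_eq N, ← Nat.card_prod, ← Nat.card_prod, ← Nat.card_coe_set_eq]
  symm
  refine Nat.card_congr (Equiv.ofBijective
    (fun t ↦ ⟨(t.1, t.1 + (t.2.1 : Fˣ) * (t.2.2 : F), t.1 + (t.2.1 : Fˣ)), ?_, ?_, ?_⟩) ⟨?_, ?_⟩)
  · obtain ⟨a, ⟨d, hd⟩, ⟨s, ⟨u, hu, rfl⟩, v, hv, hv'⟩⟩ := t
    exact ⟨d * u, mul_mem hd hu, by simp⟩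
  · obtain ⟨a, ⟨d, hd⟩, ⟨s, ⟨u, hu, rfl⟩, v, hv, hv'⟩⟩ := t
    exact ⟨d * v, mul_mem hd hv, by simp [hv']; ring⟩
  · obtain ⟨a, ⟨d, hd⟩, ⟨s, hs⟩⟩ := t
    exact ⟨d, hd, by simp⟩
  · rintro ⟨a, ⟨d, hd⟩, ⟨s, hs⟩⟩ ⟨a', ⟨d', hd'⟩, ⟨s', hs'⟩⟩ h
    simp only [Subtype.mk.injEq, Prod.mk.injEq] at h
    obtain ⟨rfl, h1, h2⟩ := h
    obtain rfl : d = d' := Units.ext (add_left_cancel h2)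
    obtain rfl : s = s' := mul_left_cancel₀ d.ne_zero (add_left_cancel h1)
    rfl
  · rintro ⟨⟨a, b, c⟩, ⟨u, hu, hu'⟩, ⟨v, hv, hv'⟩, ⟨d, hd, hd'⟩⟩
    dsimp only at hu' hv' hd'
    have h0 := d.ne_zero
    refine ⟨(a, ⟨d, hd⟩, ⟨(u : F) / d, ⟨u / d, div_mem hu hd, by simp⟩,
      ⟨v / d, div_mem hv hd, ?_⟩⟩), ?_⟩
    · rw [Units.val_div_eq_div_val]
      field_simp
      rw [hv', hu', hd']; ring
    · simp only [Subtype.mk.injEq, Prod.mk.injEq, true_and]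
      constructor
      · field_simp
        rw [hu']; ring
      · rw [hd']; ring

theorem card_powerResidues_mul (F : Type*) [Field F] [Fintype F] {k : ℕ}
    (hk : k ∣ Fintype.card F - 1) : Nat.card (powerResidues F k) * k = Fintype.card F - 1 := by
  have h := IsCyclic.card_powMonoidHom_range (G := Fˣ) k
  rw [powerResidues, h, Nat.card_units, Nat.card_eq_fintype_card, Nat.gcd_eq_right hk,
    Nat.div_mul_cancel hk]

/-! ### Uniqueness of the sum of two squares -/

/-- The representation of a prime power `q = x² + y²` with `x ≡ 1 [ZMOD 4]` prime to `q`
is essentially unique. -/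
theorem eq_of_prime_pow_eq_sq_add_sq {p r : ℕ} (hp : p.Prime) (hp2 : p ≠ 2) {x y a b : ℤ}
    (hx : (p : ℤ) ^ r = x ^ 2 + y ^ 2) (ha : (p : ℤ) ^ r = a ^ 2 + b ^ 2)
    (hx4 : x ≡ 1 [ZMOD 4]) (ha4 : a ≡ 1 [ZMOD 4]) (hpx : ¬ (p : ℤ) ∣ x) (hpa : ¬ (p : ℤ) ∣ a) :
    x = a := by
  have hpZ : Prime (p : ℤ) := Nat.prime_iff_prime_int.1 hp
  have hodd : Odd ((p : ℤ) ^ r) := by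
    have := (hp.odd_of_ne_two hp2).pow (n := r); exact_mod_cast this
  have hx4' : x % 4 = 1 := hx4
  have ha4' : a % 4 = 1 := ha4
  have hxo : Odd x := by rw [Int.odd_iff]; omega
  have hao : Odd a := by rw [Int.odd_iff]; omega
  have hye : Even y := by
    rw [hx] at hodd
    by_contra h
    exact (Int.not_even_iff_odd.2 hodd) (hxo.pow.add_odd (Int.not_even_iff_odd.1 h).pow)
  -- the case in which `q` divides `a x + b y`
  have key (z : ℤ) (hz : (p : ℤ) ^ r = x ^ 2 + z ^ 2) (hze : Even z)
      (hdvd : (p : ℤ) ^ r ∣ a * x + b * z) : x = a := by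
    obtain ⟨k, hk⟩ := hdvd
    set Q : ℤ := (p : ℤ) ^ r with hQ
    have hQ0 : 0 < Q := pow_pos (by exact_mod_cast hp.pos) r
    -- Brahmagupta's identity bounds `k`; parity, from `z` even, excludes `k = 0`.
    have hsq : (Q * k) ^ 2 + (a * z - b * x) ^ 2 = Q ^ 2 := by
      rw [← hk, pow_two Q]; nth_rewrite 1 [hz]; rw [ha]; ring
    have hko : Odd (Q * k) := by rw [← hk]; exact (hao.mul hxo).add_even (hze.mul_left b)
    have hk1 : k ^ 2 ≤ 1 := by
      by_contra! h
      nlinarith [sq_nonneg (a * z - b * x), mul_pos hQ0 hQ0]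
    have hk0 : k ≠ 0 := by rintro rfl; simp at hko
    have hkk : k = 1 ∨ k = -1 := by
      have : k ≤ 1 := by nlinarith
      have : -1 ≤ k := by nlinarith
      omega
    have hz0 : a * z - b * x = 0 := by
      rcases hkk with rfl | rfl <;> · apply pow_eq_zero_iff two_ne_zero |>.1; linarith
    have hxa : Q * x = Q * (a * k) := by
      linear_combination x * ha - b * hz0 + a * hk
    have hxa := mul_left_cancel₀ hQ0.ne' hxa
    rcases hkk with rfl | rfl <;> omega
  -- `p` cannot divide both factors, whose sum is `2 a x`, so `p ^ r` divides one of them.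
  have hmul : (p : ℤ) ^ r ∣ (a * x + b * y) * (a * x + b * (-y)) :=
    ⟨a ^ 2 + x ^ 2 - p ^ r, by linear_combination ((p:ℤ) ^ r - a ^ 2) * hx + y ^ 2 * ha⟩
  by_cases h : (p : ℤ) ∣ a * x + b * y
  · have h' : ¬ (p : ℤ) ∣ a * x + b * (-y) := by
      intro h'
      have h2 : (p : ℤ) ∣ 2 * (a * x) := by
        have := dvd_add h h'
        ring_nf at this ⊢
        exact this
      rcases hpZ.dvd_or_dvd h2 with h2 | h2
      · exact hp2 ((Nat.prime_dvd_prime_iff_eq hp Nat.prime_two).1 (by exact_mod_cast h2))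
      · exact (hpZ.dvd_or_dvd h2).elim hpa hpx
    exact key y hx hye (hpZ.pow_dvd_of_dvd_mul_right r h' hmul)
  · exact key (-y) (by rw [neg_sq]; exact hx) hye.neg (hpZ.pow_dvd_of_dvd_mul_left r h hmul)

/-! ### Binomial coefficients and power sums -/

/-- If `p ≡ 1 [MOD 4]` and `4 m + 1 = p ^ r`, then adding `m` to itself in base `p` involves
no carries. -/
theorem not_dvd_choose_of_four_mul_add_one_eq_pow {p r m : ℕ} (hp : p.Prime) (hp4 : p % 4 = 1)
    (hm : 4 * m + 1 = p ^ r) : ¬ p ∣ (m + m).choose m := by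
  -- Every base-`p` digit of `m` is `(p - 1) / 4`, so `2 (m % p ^ i) < p ^ i`.
  have hmod (i : ℕ) (hi : i ≤ r) : 4 * (m % p ^ i) + 1 = p ^ i := by
    have h1 (j : ℕ) : p ^ j % 4 = 1 := by simp [Nat.pow_mod, hp4]
    obtain ⟨s, rfl⟩ := Nat.exists_eq_add_of_le hi
    rw [pow_add] at hm
    obtain ⟨u, hu⟩ : ∃ u, p ^ i = 4 * u + 1 := ⟨p ^ i / 4, by have := h1 i; omega⟩
    obtain ⟨v, hv⟩ : ∃ v, p ^ s = 4 * v + 1 := ⟨p ^ s / 4, by have := h1 s; omega⟩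
    have : m = u + p ^ i * v := by rw [hu]; rw [hu, hv] at hm; nlinarith
    rw [this, Nat.add_mul_mod_self_left, Nat.mod_eq_of_lt (by omega), hu]
  have hpos : 0 < (m + m).choose m := Nat.choose_pos (by omega)
  rw [hp.dvd_iff_one_le_factorization hpos.ne', not_le, Nat.lt_one_iff]
  rcases Nat.eq_zero_or_pos m with rfl | hm0
  · simp
  rw [Nat.factorization_choose' hp (Nat.log_lt_of_lt_pow (by omega) (by omega : m + m < p ^ r)),
    Finset.card_eq_zero, Finset.filter_eq_empty_iff]
  intro i hi
  have := hmod i (Finset.mem_Ico.1 hi).2.le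
  omega

open MulChar

theorem FiniteField.sum_pow_of_pos {K : Type*} [Field K] [Fintype K] {i : ℕ} (hi : i ≠ 0) :
    ∑ x : K, x ^ i = if Fintype.card K - 1 ∣ i then -1 else 0 := by
  classical
  rw [← FiniteField.sum_pow_units K i]
  have h := Fintype.sum_subtype_add_sum_subtype (fun x : K ↦ x ≠ 0) (fun x ↦ x ^ i)
  rw [← h, ← unitsEquivNeZero.sum_comp]
  refine add_eq_left.2 (Finset.sum_eq_zero fun x _ ↦ ?_)
  rw [not_not.1 x.2, zero_pow hi]

/-- The reduction of a quartic Jacobi sum modulo a prime is a binomial coefficient, up to sign. -/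
theorem sum_pow_three_mul_mul_one_sub_pow {F : Type*} [Field F] [Fintype F] {m : ℕ}
    (hm0 : m ≠ 0) (hm : Fintype.card F = 4 * m + 1) :
    ∑ t : F, t ^ (3 * m) * (1 - t) ^ (2 * m) = -((-1) ^ m * ((m + m).choose m : F)) := by
  have hcard : Fintype.card F - 1 = 4 * m := by omega
  have hexp (t : F) : t ^ (3 * m) * (1 - t) ^ (2 * m) =
      ∑ j ∈ Finset.range (2 * m + 1), (-1) ^ j * ((2 * m).choose j : F) * t ^ (3 * m + j) := by
    rw [sub_eq_neg_add, add_pow, Finset.mul_sum]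
    refine Finset.sum_congr rfl fun j _ ↦ ?_
    rw [one_pow, neg_pow, pow_add]; ring
  simp_rw [hexp]
  rw [Finset.sum_comm]
  simp_rw [← Finset.mul_sum]
  -- The exponents `3m + j` run from `3m` to `5m`; only `4m` is a multiple of `q - 1`.
  rw [Finset.sum_eq_single m]
  · rw [FiniteField.sum_pow_of_pos (by omega), if_pos (by rw [hcard]; exact ⟨1, by ring⟩), two_mul]
    ring
  · intro j hj hjm
    rw [FiniteField.sum_pow_of_pos (by omega), if_neg, mul_zero]
    rw [hcard]
    rintro ⟨k, hk⟩
    have hj := Finset.mem_range.1 hj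
    obtain rfl | rfl | h2 : k = 0 ∨ k = 1 ∨ 2 ≤ k := by omega
    · omega
    · omega
    · have := Nat.mul_le_mul_left (4 * m) h2
      omega
  · intro h
    exact absurd (Finset.mem_range.2 (by omega)) h

theorem GaussianInt.isPrimitiveRoot_sqrtd : IsPrimitiveRoot (Zsqrtd.sqrtd : GaussianInt) 4 := by
  refine IsPrimitiveRoot.mk_of_lt _ (by norm_num) (by decide) ?_
  intro l h0 h4
  interval_cases l <;> decide

/-! ### Quartic characters and their Jacobi sums -/

section QuarticCharacter

variable {F : Type*} [Field F] {χ : MulChar F GaussianInt}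

theorem sq_apply_generator (hχ : orderOf χ = 4) {g : Fˣ}
    (hg : ∀ x, x ∈ Subgroup.zpowers g) : χ g ^ 2 = -1 := by
  have h4 : χ ^ 4 = 1 := hχ ▸ pow_orderOf_eq_one χ
  have h2 : χ ^ 2 ≠ 1 := pow_ne_one_of_lt_orderOf (by norm_num) (by omega)
  have e4 : χ g ^ 4 = 1 := by rw [← pow_apply_coe, h4, one_apply_coe]
  have e2 : χ g ^ 2 ≠ 1 := by
    intro h
    apply h2
    rw [MulChar.eq_iff hg, pow_apply_coe, h, one_apply_coe]
  have : (χ g ^ 2 - 1) * (χ g ^ 2 + 1) = 0 := by linear_combination e4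
  rcases mul_eq_zero.1 this with h | h
  · exact absurd (sub_eq_zero.1 h) e2
  · exact eq_neg_of_add_eq_zero_left h

variable [Fintype F]

theorem pow_half_generator {m : ℕ} (hm : Fintype.card F = 4 * m + 1) {g : Fˣ}
    (hg : ∀ x, x ∈ Subgroup.zpowers g) : (g : F) ^ (2 * m) = -1 := by
  classical
  have ho : orderOf g = 4 * m := by
    rw [orderOf_eq_card_of_forall_mem_zpowers hg, Nat.card_eq_fintype_card, Fintype.card_units]
    omega
  have hm0 : m ≠ 0 := by rintro rfl; have := Fintype.one_lt_card (α := F); omega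
  have h1 : (g : F) ^ (2 * m) ≠ 1 := by
    intro h
    exact pow_ne_one_of_lt_orderOf (by omega : 2 * m ≠ 0) (by omega : 2 * m < orderOf g)
      (Units.ext (by simpa using h))
  have h2 : (g : F) ^ (4 * m) = 1 := by
    rw [← ho, ← Units.val_pow_eq_pow_val, pow_orderOf_eq_one, Units.val_one]
  have : ((g : F) ^ (2 * m) - 1) * ((g : F) ^ (2 * m) + 1) = 0 := by linear_combination h2
  rcases mul_eq_zero.1 this with h | h
  · exact absurd (sub_eq_zero.1 h) h1
  · exact eq_neg_of_add_eq_zero_left h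

/-- With `m = (q - 1) / 4`, `-1 = g ^ (2m)` and `χ g ^ 2 = -1`; here `m` is odd. -/
theorem quartic_apply_neg_one (hχ : orderOf χ = 4) (hq : Fintype.card F % 8 = 5) :
    χ (-1) = -1 := by
  obtain ⟨g, hg⟩ := IsCyclic.exists_generator (α := Fˣ)
  have hm : Fintype.card F = 4 * (Fintype.card F / 4) + 1 := by omega
  rw [← pow_half_generator hm hg, map_pow, pow_mul, sq_apply_generator hχ hg]
  exact Odd.neg_one_pow (by rw [Nat.odd_iff]; omega)

theorem quartic_sq_eq_quadraticChar [DecidableEq F] (hχ : orderOf χ = 4)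
    (hF : ringChar F ≠ 2) (x : F) : χ x ^ 2 = (quadraticChar F x : GaussianInt) := by
  obtain ⟨g, hg⟩ := IsCyclic.exists_generator (α := Fˣ)
  have : χ ^ 2 = (quadraticChar F).ringHomComp (Int.castRingHom GaussianInt) := by
    rw [MulChar.eq_iff hg, pow_apply_coe, sq_apply_generator hχ hg, ringHomComp_apply]
    have h1 : quadraticChar F g = -1 := by
      rcases quadraticChar_dichotomy g.ne_zero with h | h
      · refine absurd ?_ (quadraticChar_ne_one hF)
        rw [MulChar.eq_iff hg, h, one_apply_coe]
      · exact h
    rw [h1]; simp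
  rw [← pow_apply' _ two_ne_zero, this, ringHomComp_apply]; rfl

theorem ringChar_ne_two_of_card (hq : Fintype.card F % 8 = 5) : ringChar F ≠ 2 := by
  intro h
  have := FiniteField.even_card_of_char_two h
  omega

theorem quartic_apply_four (hχ : orderOf χ = 4) (hq : Fintype.card F % 8 = 5) :
    χ 4 = -1 := by
  classical
  have hF := ringChar_ne_two_of_card hq
  have h4 : (4 : F) = 2 ^ 2 := by norm_num
  rw [h4, map_pow, quartic_sq_eq_quadraticChar hχ hF, quadraticChar_two hF,
    ZMod.χ₈_nat_mod_eight, hq, show ZMod.χ₈ ((5 : ℕ) : ZMod 8) = -1 by decide]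
  simp

/-- Complete the square, `4t(1 - t) = 1 - (1 - 2t)²`, and use that `u` has `1 + χ² u` square roots;
the sign is `χ 4`. -/
theorem jacobiSum_quartic_self (hχ : orderOf χ = 4) (hq : Fintype.card F % 8 = 5) :
    jacobiSum χ χ = - jacobiSum χ (χ ^ 2) := by
  classical
  have hF := ringChar_ne_two_of_card hq
  have h2 : (2 : F) ≠ 0 := Ring.two_ne_zero hF
  have hne : χ ≠ 1 := by rintro rfl; simp at hχ
  have e1 : χ 4 * jacobiSum χ χ = ∑ s : F, χ (1 - s ^ 2) := by
    rw [jacobiSum, Finset.mul_sum, ← Equiv.sum_comp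
      ((Equiv.mulLeft₀ (2 : F) h2).trans (Equiv.subLeft (1 : F))) (fun s ↦ χ (1 - s ^ 2))]
    refine Finset.sum_congr rfl fun t _ ↦ ?_
    rw [← map_mul, ← map_mul]
    congr 1
    change 4 * (t * (1 - t)) = 1 - (1 - 2 * t) ^ 2
    ring
  have e2 : ∑ s : F, χ (1 - s ^ 2) = ∑ u : F, χ (1 - u) * (χ u ^ 2 + 1) := by
    rw [← Finset.sum_fiberwise (s := Finset.univ) (g := fun s : F ↦ s ^ 2)]
    refine Finset.sum_congr rfl fun u _ ↦ ?_
    rw [Finset.sum_congr rfl (g := fun _ ↦ χ (1 - u))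
      (fun s hs ↦ by rw [(Finset.mem_filter.1 hs).2]), Finset.sum_const,
      quartic_sq_eq_quadraticChar hχ hF, nsmul_eq_mul, mul_comm]
    congr 1
    have h := quadraticChar_card_sqrts hF u
    have h' : ({x : F | x ^ 2 = u} : Set F).toFinset = Finset.univ.filter (fun s : F ↦ s ^ 2 = u) := by
      ext; simp
    rw [h'] at h
    exact_mod_cast congrArg (Int.cast : ℤ → GaussianInt) h
  have e3 : ∑ u : F, χ (1 - u) = 0 := by
    exact ((Equiv.subLeft (1 : F)).sum_comp (fun u ↦ χ u)).trans (sum_eq_zero_of_ne_one hne)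
  have e4 : ∑ u : F, χ (1 - u) * (χ u ^ 2 + 1) = jacobiSum χ (χ ^ 2) := by
    rw [jacobiSum_comm, jacobiSum]
    simp_rw [mul_add, mul_one, Finset.sum_add_distrib, e3, add_zero]
    exact Finset.sum_congr rfl fun u _ ↦ by rw [pow_apply' _ two_ne_zero, mul_comm]
  rw [e2, e4, quartic_apply_four hχ hq] at e1
  linear_combination -e1

theorem quartic_star_apply (hχ : orderOf χ = 4) (x : F) : star (χ x) = (χ ^ 3) x := by
  rw [pow_apply' _ three_ne_zero]
  rcases eq_or_ne x 0 with rfl | hx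
  · simp
  obtain ⟨k, hk, h⟩ := exists_apply_eq_pow (hχ ▸ pow_orderOf_eq_one χ)
    GaussianInt.isPrimitiveRoot_sqrtd hx
  rw [h]
  interval_cases k <;> decide

theorem quartic_star_eq (hχ : orderOf χ = 4) : star χ = χ ^ 3 :=
  MulChar.ext' fun x ↦ by rw [star_apply, quartic_star_apply hχ]

theorem star_jacobiSum {R R' : Type*} [CommRing R] [Fintype R] [CommRing R'] [StarRing R']
    (χ ψ : MulChar R R') : star (jacobiSum χ ψ) = jacobiSum (star χ) (star ψ) :=
  (jacobiSum_ringHomComp χ ψ (starRingEnd R')).symm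

/-- After embedding `ℤ[i]` in `ℂ`, inverse characters are conjugate ones, so the product formula for
Jacobi sums becomes `|J|² = q`. -/
theorem jacobiSum_quartic_norm (hχ : orderOf χ = 4) :
    (jacobiSum χ (χ ^ 2)).re ^ 2 + (jacobiSum χ (χ ^ 2)).im ^ 2 = Fintype.card F := by
  have hinj : Function.Injective GaussianInt.toComplex :=
    fun x y h ↦ GaussianInt.toComplex_inj.1 h
  have hne (k : ℕ) (h0 : k ≠ 0) (h4 : k < 4) : χ ^ k ≠ 1 :=
    pow_ne_one_of_lt_orderOf h0 (by omega)
  have hchar : ringChar ℂ ≠ ringChar F := by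
    rw [ringChar.eq ℂ 0]
    exact (CharP.ringChar_ne_zero_of_finite F).symm
  have h := jacobiSum_mul_jacobiSum_inv hchar (χ := χ.ringHomComp GaussianInt.toComplex)
    (φ := (χ ^ 2).ringHomComp GaussianInt.toComplex)
    ((ringHomComp_ne_one_iff hinj).2 (by simpa using hne 1 (by norm_num) (by norm_num)))
    ((ringHomComp_ne_one_iff hinj).2 (hne 2 (by norm_num) (by norm_num)))
    (by
      rw [← ringHomComp_mul, ← pow_succ']
      exact (ringHomComp_ne_one_iff hinj).2 (hne 3 (by norm_num) (by norm_num)))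
  rw [← star_eq_inv, ← star_eq_inv, ← star_jacobiSum, jacobiSum_ringHomComp] at h
  set J := jacobiSum χ (χ ^ 2)
  have hre := congrArg Complex.re h
  simp only [Complex.mul_re, RCLike.star_def, Complex.conj_re, Complex.conj_im,
    ← GaussianInt.intCast_re, ← GaussianInt.intCast_im, Complex.natCast_re] at hre
  have : ((J.re ^ 2 + J.im ^ 2 : ℤ) : ℝ) = ((Fintype.card F : ℤ) : ℝ) := by
    push_cast; linarith
  exact_mod_cast this

/-- A quartic Jacobi sum is not divisible by the characteristic. -/
theorem jacobiSum_quartic_not_dvd {p r : ℕ} (hχ : orderOf χ = 4) (hp : p.Prime)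
    (hp4 : p % 4 = 1) (hF : Fintype.card F = p ^ r) :
    ¬ (p : ℤ) ∣ (jacobiSum χ (χ ^ 2)).re := by
  obtain ⟨g, hg⟩ := IsCyclic.exists_generator (α := Fˣ)
  obtain ⟨m, hm⟩ : ∃ m, Fintype.card F = 4 * m + 1 := by
    have : p ^ r % 4 = 1 := by simp [Nat.pow_mod, hp4]
    exact ⟨p ^ r / 4, by rw [hF]; omega⟩
  have hcard := Fintype.one_lt_card (α := F)
  have hm0 : m ≠ 0 := by omega
  have hr : r ≠ 0 := by rintro rfl; simp at hF; omega
  have : Fact p.Prime := ⟨hp⟩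
  have hpF : CharP F p := charP_of_card_eq_prime_pow hF
  have hg2 := pow_half_generator hm hg
  have hχg := sq_apply_generator hχ hg
  -- Reduction modulo a prime above `p`. The sign of the image of `i` is chosen to turn `χ` into `x
  -- ^ (3m)`; with `x ^ m` the sum would have degree `3m < q - 1` and vanish.
  obtain ⟨φ, hφ⟩ : ∃ φ : GaussianInt →+* F, φ (χ g) = (g : F) ^ (3 * m) := by
    have hsq : ((g : F) ^ (3 * m)) * (g : F) ^ (3 * m) = -1 := by
      have : ((g : F) ^ (3 * m)) * (g : F) ^ (3 * m) = ((g : F) ^ (2 * m)) ^ 3 := by ring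
      rw [this, hg2]; norm_num
    set w := (g : F) ^ (3 * m)
    have hz : χ g = Zsqrtd.sqrtd ∨ χ g = -Zsqrtd.sqrtd := by
      have hs : (Zsqrtd.sqrtd : GaussianInt) ^ 2 = -1 := by decide
      exact sq_eq_sq_iff_eq_or_eq_neg.1 (hχg.trans hs.symm)
    rcases hz with hz | hz
    · refine ⟨Zsqrtd.lift ⟨w, by simpa using hsq⟩, ?_⟩
      rw [hz]; simp
    · refine ⟨Zsqrtd.lift ⟨-w, by simpa using hsq⟩, ?_⟩
      rw [hz]; simp
  have hφχ (x : F) : φ (χ x) = x ^ (3 * m) := by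
    rcases eq_or_ne x 0 with rfl | hx
    · simp [hm0]
    · obtain ⟨k, hk⟩ := (Submonoid.mem_powers_iff _ _).1
        (mem_powers_iff_mem_zpowers.2 (hg (Units.mk0 x hx)))
      have : x = (g : F) ^ k := by simpa using (congrArg Units.val hk).symm
      rw [this, map_pow, map_pow, hφ, pow_right_comm]
  have hJ : φ (jacobiSum χ (χ ^ 2)) ≠ 0 := by
    have : φ (jacobiSum χ (χ ^ 2)) = ∑ t : F, t ^ (3 * m) * (1 - t) ^ (2 * m) := by
      rw [jacobiSum, map_sum]
      refine Finset.sum_congr rfl fun t _ ↦ ?_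
      rw [map_mul, hφχ, pow_apply' _ two_ne_zero, map_pow, hφχ]
      congr 1
      rcases eq_or_ne (1 - t) 0 with h | h
      · rw [h]; simp [hm0]
      · have := FiniteField.pow_card_sub_one_eq_one _ h
        rw [hm, Nat.add_sub_cancel] at this
        calc ((1 - t) ^ (3 * m)) ^ 2 = (1 - t) ^ (4 * m) * (1 - t) ^ (2 * m) := by ring
          _ = _ := by rw [this, one_mul]
    rw [this, sum_pow_three_mul_mul_one_sub_pow hm0 hm]
    refine neg_ne_zero.2 (mul_ne_zero (pow_ne_zero _ (neg_ne_zero.2 one_ne_zero)) ?_)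
    rw [Ne, CharP.cast_eq_zero_iff F p]
    exact not_dvd_choose_of_four_mul_add_one_eq_pow hp hp4 (hm.symm.trans hF)
  intro hre
  -- If `p ∣ Re J`, the norm forces `p ∣ Im J`, hence `φ J = 0`.
  have hnorm := jacobiSum_quartic_norm hχ
  set J := jacobiSum χ (χ ^ 2)
  have him : (p : ℤ) ∣ J.im := by
    refine (Nat.prime_iff_prime_int.1 hp).dvd_of_dvd_pow (n := 2) ?_
    refine (dvd_add_right (hre.pow two_ne_zero)).1 ?_
    rw [hnorm, hF]
    exact_mod_cast dvd_pow_self p hr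
  obtain ⟨u, hu⟩ := hre
  obtain ⟨v, hv⟩ := him
  have : J = (p : GaussianInt) * ⟨u, v⟩ := by
    ext <;> simp [hu, hv]
  exact hJ (by rw [this, map_mul, map_natCast, CharP.cast_eq_zero, zero_mul])

/-! ### The cyclotomic number of order four -/

-- Orthogonality: off the kernel of `χ`, which is the group of fourth powers, the geometric sum `1 +
-- χ + χ² + χ³` vanishes.
open Classical in
theorem sum_quartic_powers (hχ : orderOf χ = 4) (x : F) :
    (1 : MulChar F GaussianInt) x + χ x + (χ ^ 2) x + (χ ^ 3) x =
      if ∃ u ∈ powerResidues F 4, (u : F) = x then 4 else 0 := by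
  rcases eq_or_ne x 0 with rfl | hx
  · simp
  obtain ⟨g, hg⟩ := IsCyclic.exists_generator (α := Fˣ)
  have hg2 := sq_apply_generator hχ hg
  obtain ⟨k, hk⟩ := (Submonoid.mem_powers_iff _ _).1
    (mem_powers_iff_mem_zpowers.2 (hg (Units.mk0 x hx)))
  have hxk : x = ((g ^ k : Fˣ) : F) := by simpa using (congrArg Units.val hk).symm
  have hiff : (∃ u ∈ powerResidues F 4, (u : F) = x) ↔ χ x = 1 := by
    constructor
    · rintro ⟨_, ⟨v, rfl⟩, rfl⟩
      have h : χ ^ 4 = 1 := hχ ▸ pow_orderOf_eq_one χ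
      rw [powMonoidHom_apply, Units.val_pow_eq_pow_val, map_pow, ← pow_apply_coe, h, one_apply_coe]
    · intro h
      rw [hxk, Units.val_pow_eq_pow_val, map_pow] at h
      have ho : orderOf (χ g) = 4 := by
        refine orderOf_eq_prime_pow (p := 2) (n := 1) ?_ ?_
        · rw [pow_one, hg2]; decide
        · rw [show 2 ^ (1 + 1) = 2 * 2 by norm_num, pow_mul, hg2]; norm_num
      obtain ⟨j, rfl⟩ := ho ▸ orderOf_dvd_of_pow_eq_one h
      exact ⟨g ^ (4 * j), ⟨g ^ j, by rw [powMonoidHom_apply, ← pow_mul, mul_comm]⟩, hxk.symm⟩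
  have hx4 : χ x ^ 4 = 1 := by
    rw [hxk, Units.val_pow_eq_pow_val, map_pow, ← pow_mul, mul_comm, pow_mul,
      show 4 = 2 * 2 by norm_num, pow_mul, hg2]
    norm_num
  rw [one_apply (isUnit_iff_ne_zero.2 hx), pow_apply' _ two_ne_zero, pow_apply' _ three_ne_zero]
  simp only [hiff]
  split_ifs with h
  · rw [h]; norm_num
  · have : (χ x - 1) * (1 + χ x + χ x ^ 2 + χ x ^ 3) = 0 := by linear_combination hx4
    exact (mul_eq_zero.1 this).resolve_left (sub_ne_zero.2 h)

/-- The cyclotomic number `(0, 0)` of order four, in terms of a quartic Jacobi sum. -/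
theorem sixteen_mul_ncard_powerResidues_four (hχ : orderOf χ = 4)
    (hq : Fintype.card F % 8 = 5) :
    16 * ({s : F | (∃ u ∈ powerResidues F 4, (u : F) = s) ∧
        ∃ u ∈ powerResidues F 4, (u : F) = 1 - s}.ncard : ℤ) =
      Fintype.card F - 7 + 2 * (jacobiSum χ (χ ^ 2)).re := by
  classical
  set N := {s : F | (∃ u ∈ powerResidues F 4, (u : F) = s) ∧
        ∃ u ∈ powerResidues F 4, (u : F) = 1 - s}
  have hne (k : ℕ) (h0 : k ≠ 0) (h4 : k < 4) : χ ^ k ≠ 1 :=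
    pow_ne_one_of_lt_orderOf h0 (by omega)
  have hχ4 : χ ^ 4 = 1 := hχ ▸ pow_orderOf_eq_one χ
  have n1 : χ ≠ 1 := by simpa using hne 1 (by norm_num) (by norm_num)
  have n2 := hne 2 (by norm_num) (by norm_num)
  have n3 := hne 3 (by norm_num) (by norm_num)
  have i1 : χ⁻¹ = χ ^ 3 := inv_eq_of_mul_eq_one_right (by rw [← pow_succ', hχ4])
  have i2 : (χ ^ 2)⁻¹ = χ ^ 2 := inv_eq_of_mul_eq_one_right (by rw [← pow_add, hχ4])
  have s2 : star (χ ^ 2) = χ ^ 2 := by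
    rw [star_pow, quartic_star_eq hχ, ← pow_mul, show 3 * 2 = 4 + 2 by norm_num, pow_add, hχ4,
      one_mul]
  have j13 := jacobiSum_nontrivial_inv n1
  rw [i1, quartic_apply_neg_one hχ hq] at j13
  have j22 := jacobiSum_nontrivial_inv n2
  rw [i2, pow_apply' _ two_ne_zero, quartic_apply_neg_one hχ hq] at j22
  have j11 := jacobiSum_quartic_self hχ hq
  have j32 := star_jacobiSum χ (χ ^ 2)
  rw [s2, quartic_star_eq hχ] at j32
  have j33 := star_jacobiSum χ χ
  rw [j11, quartic_star_eq hχ, star_neg] at j33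
  have total : (16 : GaussianInt) * N.ncard = ∑ s : F,
      ((1 : MulChar F GaussianInt) s + χ s + (χ ^ 2) s + (χ ^ 3) s) *
      ((1 : MulChar F GaussianInt) (1 - s) + χ (1 - s) + (χ ^ 2) (1 - s) + (χ ^ 3) (1 - s)) := by
    have hN : N.ncard = (Finset.univ.filter (fun s ↦ s ∈ N)).card := by
      rw [Set.ncard_eq_toFinset_card']; congr 1; ext; simp
    rw [hN, Finset.card_eq_sum_ones, Finset.sum_filter, Nat.cast_sum, Finset.mul_sum]
    refine Finset.sum_congr rfl fun s _ ↦ ?_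
    rw [sum_quartic_powers hχ, sum_quartic_powers hχ, ite_zero_mul_ite_zero]
    by_cases h : s ∈ N
    · rw [if_pos h, if_pos (by exact h)]; norm_num
    · rw [if_neg h, if_neg (by exact h)]; norm_num
  have expand : ∑ s : F,
      ((1 : MulChar F GaussianInt) s + χ s + (χ ^ 2) s + (χ ^ 3) s) *
      ((1 : MulChar F GaussianInt) (1 - s) + χ (1 - s) + (χ ^ 2) (1 - s) + (χ ^ 3) (1 - s)) =
      jacobiSum (1 : MulChar F GaussianInt) 1 + 2 * jacobiSum 1 χ + 2 * jacobiSum 1 (χ ^ 2) +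
      2 * jacobiSum 1 (χ ^ 3) + jacobiSum χ χ + 2 * jacobiSum χ (χ ^ 2) +
      2 * jacobiSum χ (χ ^ 3) + jacobiSum (χ ^ 2) (χ ^ 2) + 2 * jacobiSum (χ ^ 3) (χ ^ 2) +
      jacobiSum (χ ^ 3) (χ ^ 3) := by
    -- Undoing the symmetry of Jacobi sums makes the expansion a termwise identity.
    have c (ψ ψ' : MulChar F GaussianInt) :
        2 * jacobiSum ψ ψ' = jacobiSum ψ ψ' + jacobiSum ψ' ψ := by
      rw [jacobiSum_comm ψ' ψ, two_mul]
    simp only [c]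
    simp only [jacobiSum, ← Finset.sum_add_distrib]
    exact Finset.sum_congr rfl fun s _ ↦ by ring
  rw [expand, jacobiSum_one_one, jacobiSum_one_nontrivial n1, jacobiSum_one_nontrivial n2,
    jacobiSum_one_nontrivial n3, j11, j13, j22, ← j32, ← j33] at total
  set J := jacobiSum χ (χ ^ 2)
  have hre := congrArg Zsqrtd.re total
  simp [pow_two] at hre
  linarith

end QuarticCharacter

/-! ### Conclusion -/

theorem corollary2p9 {F : Type*} [Field F] [Fintype F] (p r q : ℕ) (hp : p.Prime)
    (hq : q = p ^ r) (hF : Fintype.card F = q) (hq8 : q ≡ 5 [MOD 8]) :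
    (∃ x y : ℤ, (q : ℤ) = x ^ 2 + y ^ 2 ∧ x ≡ 1 [ZMOD 4] ∧ ¬ (p : ℤ) ∣ x) ∧
    ∀ x y : ℤ, (q : ℤ) = x ^ 2 + y ^ 2 → x ≡ 1 [ZMOD 4] → ¬ (p : ℤ) ∣ x →
      (numTransitiveSubtournaments 3 (paleyDigraph F 4) : ℚ) =
        (q : ℚ) * ((q : ℚ) - 1) * ((q : ℚ) + 2 * (x : ℚ) - 7) / 2 ^ 6 := by
  have hq8' : q % 8 = 5 := hq8
  -- Squares are `0, 1, 4` mod 8, so `r` is odd and `p ≡ q`.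
  have hp4 : p % 8 = 5 := by
    have h1 : p ^ r % 8 = 5 := hq ▸ hq8'
    have hsq (a : ℕ) (ha : a < 8) : a * a % 8 = 0 ∨ a * a % 8 = 1 ∨ a * a % 8 = 4 := by
      interval_cases a <;> simp
    have hk (k : ℕ) : (p * p) ^ k % 8 = 0 ∨ (p * p) ^ k % 8 = 1 ∨ (p * p) ^ k % 8 = 4 := by
      rw [mul_pow, Nat.mul_mod]; exact hsq _ (Nat.mod_lt _ (by norm_num))
    obtain ⟨k, rfl | rfl⟩ := Nat.even_or_odd' r
    · rw [pow_mul, pow_two] at h1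
      have := hk k
      omega
    · rw [pow_succ, pow_mul, pow_two, Nat.mul_mod] at h1
      have hlt : p % 8 < 8 := Nat.mod_lt _ (by norm_num)
      rcases hk k with h | h | h <;> rw [h] at h1 <;> omega
  have hF8 : Fintype.card F % 8 = 5 := hF ▸ hq8'
  have hFr : Fintype.card F = p ^ r := hF.trans hq
  obtain ⟨χ, hχ⟩ := MulChar.exists_mulChar_orderOf F (n := 4) (by omega)
    GaussianInt.isPrimitiveRoot_sqrtd
  have hnorm := jacobiSum_quartic_norm hχ
  have hcount := sixteen_mul_ncard_powerResidues_four hχ hF8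
  have hndvd := jacobiSum_quartic_not_dvd hχ hp (by omega) hFr
  set a := (jacobiSum χ (χ ^ 2)).re
  set b := (jacobiSum χ (χ ^ 2)).im
  rw [hF] at hnorm hcount
  -- From `2a = 16 N + 7 - q` and `q ≡ 5 mod 8`.
  have ha4 : a ≡ 1 [ZMOD 4] := by
    rw [Int.ModEq]
    omega
  refine ⟨⟨a, b, hnorm.symm, ha4, hndvd⟩, fun x y hxy hx4 hpx ↦ ?_⟩
  have hqZ : (q : ℤ) = (p : ℤ) ^ r := by exact_mod_cast hq
  obtain rfl : x = a := eq_of_prime_pow_eq_sq_add_sq hp (by omega) (hqZ ▸ hxy) (hqZ ▸ hnorm.symm)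
    hx4 ha4 hpx hndvd
  have hloop (v : F) : ¬ (paleyDigraph F 4).Adj v v := by
    rintro ⟨u, -, hu⟩
    exact u.ne_zero (hu.trans (sub_self v))
  have hcard := card_powerResidues_mul F (k := 4) (by omega)
  rw [hF] at hcard
  rw [numTransitiveSubtournaments_three _ hloop, ncard_transitive_triples_paleyDigraph,
    Nat.card_eq_fintype_card, hF]
  have h1 : (Nat.card (powerResidues F 4) : ℚ) * 4 = q - 1 := by
    rw [eq_sub_iff_add_eq]
    exact_mod_cast (by omega : Nat.card (powerResidues F 4) * 4 + 1 = q)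
  have h2 := congrArg (Int.cast : ℤ → ℚ) hcount
  push_cast at h2 ⊢
  rw [← h1, show (q : ℚ) + 2 * (a : ℚ) - 7 = q - 7 + 2 * a by ring, ← h2]
  ring
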